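/- Let $\Lambda$ be a countable discrete group. A trace on $\Lambda$ is a function $\varphi:\Lambda\to\mathbb{C}$ that is positive definite (all matrices $(\varphi(g_i^{-1}g_j))_{i,j}$ are positive semidefinite), conjugation invariant and normalized by $\varphi(e)=1$; a character is an extreme point of the convex set of traces. Suppose that $\Lambda$ is character rigid, that is, every character of $\Lambda$ either is of the form $\frac{1}{\dim\pi}\operatorname{tr}\circ\pi$ for some finite-dimensional irreducible unitary representation $\pi$ of $\Lambda$, or vanishes outside the center $Z(\Lambda)$. Suppose also that $\Lambda$ has at most countably many finite-dimensional unitary representations up to unitary equivalence. Let $\Lambda\curvearrowright(X,\mu)$ be an ergodic probability measure preserving action by Borel automorphisms on a standard Borel probability space. Then either the action is essentially transitive (some $\Lambda$-orbit has full measure), or $\mu(\{x\in X : gx=x\})=0$ for every $g\in\Lambda\setminus Z(\Lambda)$. -/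

import Mathlib

open MeasureTheory
open scoped ComplexOrder

namespace CharRigid

/-- `φ` is positive definite: all matrices `(φ (gᵢ⁻¹ gⱼ))ᵢⱼ` are positive semidefinite. -/
def IsPositiveDefinite {G : Type*} [Group G] (φ : G → ℂ) : Prop :=
  ∀ (n : ℕ) (g : Fin n → G), (Matrix.of fun i j => φ ((g i)⁻¹ * g j)).PosSemidef

/-- A trace on `G`: a normalized, conjugation invariant, positive definite function. -/
structure IsTrace {G : Type*} [Group G] (φ : G → ℂ) : Prop where
  positiveDefinite : IsPositiveDefinite φ
  map_one : φ 1 = 1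
  map_conj : ∀ g h : G, φ (g * h * g⁻¹) = φ h

/-- A character of `G`: an extreme point of the convex set of traces on `G`. -/
def IsCharacter {G : Type*} [Group G] (φ : G → ℂ) : Prop :=
  φ ∈ Set.extremePoints ℝ {ψ : G → ℂ | IsTrace ψ}

/-- Unitary representations of `G` on `ℂⁿ` (with its standard inner product). -/
abbrev UnitaryRep (G : Type*) [Group G] (n : ℕ) : Type _ :=
  G →* Matrix.unitaryGroup (Fin n) ℂ

/-- The linear representation on `ℂⁿ` underlying a unitary representation. -/
noncomputable def UnitaryRep.toRepresentation {G : Type*} [Group G] {n : ℕ}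
    (π : UnitaryRep G n) : Representation ℂ G (Fin n → ℂ) where
  toFun g := Matrix.toLin' (π g : Matrix (Fin n) (Fin n) ℂ)
  map_one' := by simp [Module.End.one_eq_id]
  map_mul' g h := by simp [Matrix.toLin'_mul, Module.End.mul_eq_comp]

/-- `φ` is of the form `(1 / dim π) tr ∘ π` for some finite-dimensional irreducible unitary
representation `π` (irreducible representations are nonzero, so `n ≠ 0` here). -/
def IsFiniteDimensionalCharacter {G : Type*} [Group G] (φ : G → ℂ) : Prop :=
  ∃ (n : ℕ) (π : UnitaryRep G n), π.toRepresentation.IsIrreducible ∧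
    ∀ g : G, φ g = (1 / (n : ℂ)) * (π g : Matrix (Fin n) (Fin n) ℂ).trace

/-- `G` is character rigid: every character is finite-dimensional or vanishes outside the center. -/
def IsCharacterRigid (G : Type*) [Group G] : Prop :=
  ∀ φ : G → ℂ, IsCharacter φ →
    IsFiniteDimensionalCharacter φ ∨ ∀ g : G, g ∉ Subgroup.center G → φ g = 0

/-- Unitary equivalence of `n`-dimensional unitary representations. -/
def unitaryEquivalence (G : Type*) [Group G] (n : ℕ) : Setoid (UnitaryRep G n) where
  r π σ := ∃ u : Matrix.unitaryGroup (Fin n) ℂ, ∀ g : G, σ g = u * π g * u⁻¹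
  iseqv :=
    { refl := fun π => ⟨1, fun g => by simp⟩
      symm := by
        rintro π σ ⟨u, hu⟩
        exact ⟨u⁻¹, fun g => by rw [hu g]; group⟩
      trans := by
        rintro π σ τ ⟨u, hu⟩ ⟨v, hv⟩
        exact ⟨v * u, fun g => by rw [hv g, hu g]; group⟩ }

/-- `G` has at most countably many finite-dimensional unitary representations, up to unitary
equivalence. -/
def HasCountablyManyFinDimUnitaryReps (G : Type*) [Group G] : Prop :=
  Countable (Σ n : ℕ, Quotient (unitaryEquivalence G n))

/-- The action of `G` on `(X, μ)` is essentially transitive: some orbit is conull. -/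
def IsEssentiallyTransitive (G : Type*) {X : Type*} [Group G] [MulAction G X]
    [MeasurableSpace X] (μ : Measure X) : Prop :=
  ∃ x : X, ∀ᵐ y ∂μ, y ∈ MulAction.orbit G x

end CharRigid

/-! The function φ(g) = μ(Fix g) is a trace. Choquet's theorem writes it as the barycenter of a
probability measure m on characters. Finite-dimensional characters form a countable set, so there
are two cases. If m charges none of them, rigidity makes almost every character vanish off the
center, and so does φ. Otherwise some finite-dimensional χ is an atom of mass a > 0, and φ - aχ is
positive definite.

In the second case Schur products show that |φ|² - a²|χ|² is positive definite. Since π ⊗ π̄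
contains the trivial representation, |χ|² dominates a multiple of the constant 1. As φ² ≤ φ, this
gives ε > 0 with ∑ c(g)c(h)φ(g⁻¹h) ≥ ε for all finitely supported probability vectors c
(`IsPositiveDefinite.exists_sq_sum_le`).

That sum is the integral over x of the squared ℓ² norm of the push-forward of c to the orbit of x. A
near-minimizer c is almost invariant under translation, yet its push-forward has average mass at
least ε - τ at the base point (`exists_near_minimizer`). On an infinite orbit an almost invariant
probability vector has little mass at any one point, so finite orbits have positive measure
(`not_ae_infinite_orbit`), and ergodicity leaves a single orbit up to a null set. -/

namespace CharRigid

/-! ### Choquet's theorem via upper envelopes and Hahn–Banach -/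

section Choquet

variable {Y : Type*} [TopologicalSpace Y]

/-- The value at `x` of the upper envelope of `f` with respect to the function space `A`. -/
noncomputable def upperEnvelope (A : Submodule ℝ C(Y, ℝ)) (x : Y) (f : C(Y, ℝ)) : ℝ :=
  sInf ((fun h : C(Y, ℝ) => h x) '' {h | h ∈ A ∧ f ≤ h})

variable {A : Submodule ℝ C(Y, ℝ)} {x : Y}

theorem bddBelow_upperEnvelope (f : C(Y, ℝ)) :
    BddBelow ((fun h : C(Y, ℝ) => h x) '' {h | h ∈ A ∧ f ≤ h}) :=
  ⟨f x, by rintro _ ⟨h, ⟨-, hf⟩, rfl⟩; exact hf x⟩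

theorem upperEnvelope_le {f h : C(Y, ℝ)} (hA : h ∈ A) (hf : f ≤ h) :
    upperEnvelope A x f ≤ h x :=
  csInf_le (bddBelow_upperEnvelope f) ⟨h, ⟨hA, hf⟩, rfl⟩

variable [CompactSpace Y]

theorem nonempty_upperEnvelope (hA : (1 : C(Y, ℝ)) ∈ A) (f : C(Y, ℝ)) :
    ((fun h : C(Y, ℝ) => h x) '' {h | h ∈ A ∧ f ≤ h}).Nonempty := by
  refine ⟨_, ‖f‖ • (1 : C(Y, ℝ)), ⟨A.smul_mem _ hA, fun y => ?_⟩, rfl⟩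
  simpa using (le_abs_self _).trans (f.norm_coe_le_norm y)

theorem exists_lt_of_upperEnvelope_lt (hA : (1 : C(Y, ℝ)) ∈ A) {f : C(Y, ℝ)} {r : ℝ}
    (hr : upperEnvelope A x f < r) : ∃ h ∈ A, f ≤ h ∧ h x < r := by
  obtain ⟨_, ⟨h, ⟨hh, hf⟩, rfl⟩, hlt⟩ := exists_lt_of_csInf_lt (nonempty_upperEnvelope hA f) hr
  exact ⟨h, hh, hf, hlt⟩

theorem le_upperEnvelope (hA : (1 : C(Y, ℝ)) ∈ A) (f : C(Y, ℝ)) :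
    f x ≤ upperEnvelope A x f :=
  le_csInf (nonempty_upperEnvelope hA f) (by rintro _ ⟨h, ⟨-, hf⟩, rfl⟩; exact hf x)

theorem upperEnvelope_add_le (hA : (1 : C(Y, ℝ)) ∈ A) (f g : C(Y, ℝ)) :
    upperEnvelope A x (f + g) ≤ upperEnvelope A x f + upperEnvelope A x g := by
  refine le_of_forall_pos_le_add fun ε hε => ?_
  obtain ⟨h, hh, hf, hlt⟩ := exists_lt_of_upperEnvelope_lt hA
    (show upperEnvelope A x f < upperEnvelope A x f + ε / 2 by linarith)
  obtain ⟨k, hk, hg, hlt'⟩ := exists_lt_of_upperEnvelope_lt hA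
    (show upperEnvelope A x g < upperEnvelope A x g + ε / 2 by linarith)
  have := upperEnvelope_le (x := x) (A.add_mem hh hk) (add_le_add hf hg)
  simp only [ContinuousMap.add_apply] at this
  linarith

theorem upperEnvelope_smul_le (hA : (1 : C(Y, ℝ)) ∈ A) {c : ℝ} (hc : 0 < c) (f : C(Y, ℝ)) :
    upperEnvelope A x (c • f) ≤ c * upperEnvelope A x f := by
  refine le_of_forall_pos_le_add fun ε hε => ?_
  obtain ⟨h, hh, hf, hlt⟩ := exists_lt_of_upperEnvelope_lt hA
    (show upperEnvelope A x f < upperEnvelope A x f + ε / c by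
      have := div_pos hε hc; linarith)
  have := upperEnvelope_le (x := x) (A.smul_mem c hh)
    (show c • f ≤ c • h from fun y => mul_le_mul_of_nonneg_left (hf y) hc.le)
  simp only [ContinuousMap.smul_apply, smul_eq_mul] at this
  refine this.trans ((mul_le_mul_of_nonneg_left hlt.le hc.le).trans (le_of_eq ?_))
  field_simp

theorem upperEnvelope_smul (hA : (1 : C(Y, ℝ)) ∈ A) {c : ℝ} (hc : 0 < c) (f : C(Y, ℝ)) :
    upperEnvelope A x (c • f) = c * upperEnvelope A x f := by
  refine (upperEnvelope_smul_le hA hc f).antisymm ?_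
  have := upperEnvelope_smul_le (x := x) hA (inv_pos.2 hc) (c • f)
  rw [smul_smul, inv_mul_cancel₀ hc.ne', one_smul] at this
  calc c * upperEnvelope A x f ≤ c * (c⁻¹ * upperEnvelope A x (c • f)) :=
        mul_le_mul_of_nonneg_left this hc.le
    _ = _ := by field_simp

theorem upperEnvelope_of_mem (hA : (1 : C(Y, ℝ)) ∈ A) {h : C(Y, ℝ)} (hh : h ∈ A) :
    upperEnvelope A x h = h x :=
  (upperEnvelope_le hh le_rfl).antisymm (le_upperEnvelope hA h)

/-- A functional dominated by the upper envelope and attaining it at `F`. -/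
theorem exists_linear_le_upperEnvelope (hA : (1 : C(Y, ℝ)) ∈ A) (F : C(Y, ℝ)) :
    ∃ ℓ : C(Y, ℝ) →ₗ[ℝ] ℝ, ℓ F = upperEnvelope A x F ∧ ∀ f, ℓ f ≤ upperEnvelope A x f := by
  have h0 : upperEnvelope A x 0 = 0 := upperEnvelope_of_mem hA A.zero_mem
  have H : ∀ c : ℝ, c • F = 0 → c • upperEnvelope A x F = 0 := fun c hc => by
    rcases smul_eq_zero.1 hc with h | h
    · simp [h]
    · simp [h, h0]
  obtain ⟨ℓ, h1, h2⟩ := exists_extension_of_le_sublinear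
    (LinearPMap.mkSpanSingleton' F (upperEnvelope A x F) H) (upperEnvelope A x) (fun c hc f => upperEnvelope_smul hA hc f)
    (upperEnvelope_add_le hA) (by
      rintro ⟨f, hf⟩
      obtain ⟨c, rfl⟩ := Submodule.mem_span_singleton.1 hf
      rw [LinearPMap.mkSpanSingleton'_apply, smul_eq_mul]
      rcases lt_trichotomy c 0 with hc | rfl | hc
      -- For c < 0, subadditivity bounds 0 by the sum of the envelopes of cF and -cF, and the latter
      -- is -c times the envelope of F.
      · have e1 := upperEnvelope_smul (x := x) hA (neg_pos.2 hc) F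
        have e2 := upperEnvelope_add_le (x := x) hA (c • F) ((-c) • F)
        rw [← add_smul, add_neg_cancel, zero_smul, h0, e1] at e2
        simp only [RingHom.id_apply]
        linarith
      · simp [h0]
      · exact (upperEnvelope_smul hA hc F).ge)
  refine ⟨ℓ, (h1 ⟨F, Submodule.mem_span_singleton_self F⟩).trans ?_, h2⟩
  exact LinearPMap.mkSpanSingleton'_apply_self (S := ℝ) _ _ H _

/-- A positive functional on the continuous functions on a compact space is an integral. -/
theorem exists_measure_integral_eq [T2Space Y] [MeasurableSpace Y] [BorelSpace Y]
    (ℓ : C(Y, ℝ) →ₗ[ℝ] ℝ) (hℓ : ∀ f, 0 ≤ f → 0 ≤ ℓ f) :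
    ∃ m : Measure Y, IsFiniteMeasure m ∧ ∀ f : C(Y, ℝ), ∫ y, f y ∂m = ℓ f := by
  let Φ : CompactlySupportedContinuousMap Y ℝ →ₚ[ℝ] ℝ := PositiveLinearMap.mk₀
    { toFun := fun f => ℓ f.toContinuousMap
      map_add' := fun f g => ℓ.map_add _ _
      map_smul' := fun c f => ℓ.map_smul _ _ } (fun f hf => hℓ _ hf)
  refine ⟨RealRMK.rieszMeasure Φ, ⟨isCompact_univ.measure_lt_top⟩, fun f => ?_⟩
  exact RealRMK.integral_rieszMeasure Φ (CompactlySupportedContinuousMap.continuousMapEquiv f)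

/-- A representing measure for `x` with respect to `A` that is maximal for `F`. -/
theorem exists_representing_measure [T2Space Y] [MeasurableSpace Y] [BorelSpace Y]
    (hA : (1 : C(Y, ℝ)) ∈ A) (F : C(Y, ℝ)) (x : Y) :
    ∃ m : Measure Y, IsProbabilityMeasure m ∧ (∀ h ∈ A, ∫ y, h y ∂m = h x) ∧
      ∀ᵐ y ∂m, ∀ ε > 0, ∃ h ∈ A, F ≤ h ∧ h y < F y + ε := by
  obtain ⟨ℓ, hF, hle⟩ := exists_linear_le_upperEnvelope (x := x) hA F
  have hℓA : ∀ h ∈ A, ℓ h = h x := fun h hh => by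
    refine ((hle h).trans_eq (upperEnvelope_of_mem hA hh)).antisymm ?_
    have := (hle (-h)).trans_eq (upperEnvelope_of_mem hA (A.neg_mem hh))
    rw [map_neg, ContinuousMap.neg_apply] at this
    linarith
  -- Positivity of ℓ: if f ≥ 0, then 0 ∈ A majorizes -f, so ℓ(-f) ≤ 0.
  obtain ⟨m, hm, hint⟩ := exists_measure_integral_eq ℓ (fun f hf => by
    have := (hle (-f)).trans (upperEnvelope_le A.zero_mem (neg_nonpos.2 hf))
    rw [map_neg, ContinuousMap.zero_apply] at this
    linarith)
  have hprob : IsProbabilityMeasure m := by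
    have := (hint 1).trans (hℓA 1 hA)
    simp only [ContinuousMap.one_apply, integral_const, smul_eq_mul, mul_one] at this
    exact ⟨by rw [← ENNReal.toReal_eq_one_iff]; exact this⟩
  refine ⟨m, hprob, fun h hh => (hint h).trans (hℓA h hh), ?_⟩
  have hi : ∀ f : C(Y, ℝ), Integrable f m := fun f =>
    (BoundedContinuousFunction.mkOfCompact f).integrable m
  have key : ∀ k : ℕ, ∀ᵐ y ∂m, ∃ h ∈ A, F ≤ h ∧ h y < F y + 1 / ((k : ℝ) + 1) := by
    intro k
    have hk : (0 : ℝ) < 1 / ((k : ℝ) + 1) := by positivity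
    rw [ae_iff, ← measureReal_eq_zero_iff]
    refine le_antisymm ?_ measureReal_nonneg
    refine le_of_forall_pos_le_add fun ε hε => ?_
    -- Since ℓ F equals the envelope at x, the integral of h - F is below ε / (k + 1); Markov's
    -- inequality then bounds the exceptional set by ε.
    obtain ⟨h, hh, hFh, hlt⟩ := exists_lt_of_upperEnvelope_lt hA
      (show upperEnvelope A x F < upperEnvelope A x F + ε * (1 / ((k : ℝ) + 1)) by
        have := mul_pos hε hk; linarith)
    have h1 := mul_meas_ge_le_integral_of_nonneg (μ := m) (f := fun y => (h - F) y)
      (ae_of_all _ fun y => sub_nonneg.2 (hFh y)) (hi _) (1 / ((k : ℝ) + 1))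
    rw [hint, map_sub, hF, hℓA h hh] at h1
    have h2 : m.real {y | ¬ ∃ h ∈ A, F ≤ h ∧ h y < F y + 1 / ((k : ℝ) + 1)} ≤
        m.real {y | 1 / ((k : ℝ) + 1) ≤ (h - F) y} := by
      refine measureReal_mono fun y hy => ?_
      by_contra hcon
      refine hy ⟨h, hh, hFh, ?_⟩
      have : ¬ 1 / ((k : ℝ) + 1) ≤ h y - F y := hcon
      linarith
    rw [zero_add]
    refine h2.trans (le_of_mul_le_mul_left ?_ hk)
    linarith
  filter_upwards [ae_all_iff.2 key] with y hy ε hε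
  obtain ⟨k, hk⟩ := exists_nat_one_div_lt hε
  obtain ⟨h, hh, hF, hlt⟩ := hy k
  exact ⟨h, hh, hF, by linarith⟩

/-- **Choquet's theorem** for a compact set carrying a continuous strictly convex function. -/
theorem exists_measure_extremePoints {E : Type*} [AddCommGroup E] [Module ℝ E]
    [TopologicalSpace E] [T2Space E] [MeasurableSpace E] [BorelSpace E]
    {K : Set E} (hK : IsCompact K) {F : E → ℝ} (hFc : ContinuousOn F K)
    (hF : StrictConvexOn ℝ K F) (x : K) :
    ∃ m : Measure K, IsProbabilityMeasure m ∧
      (∀ L : E →L[ℝ] ℝ, ∫ y : K, L y ∂m = L x) ∧ ∀ᵐ y : K ∂m, (y : E) ∈ K.extremePoints ℝ := by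
  have : CompactSpace K := isCompact_iff_compactSpace.1 hK
  let T : (ℝ × (E →L[ℝ] ℝ)) →ₗ[ℝ] C(K, ℝ) :=
    { toFun := fun p => ⟨fun y => p.1 + p.2 y, by fun_prop⟩
      map_add' := fun p q => by ext y; simp; ring
      map_smul' := fun c p => by ext y; simp; ring }
  obtain ⟨m, hm, hrep, hae⟩ := exists_representing_measure (A := LinearMap.range T)
    ⟨(1, 0), by ext y; simp [T]⟩ ⟨fun y : K => F y, hFc.domRestrict⟩ x
  refine ⟨m, hm, fun L => ?_, ?_⟩
  · simpa [T] using hrep (T (0, L)) ⟨_, rfl⟩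
  · filter_upwards [hae] with y hy
    refine ⟨y.2, fun x₁ h₁ x₂ h₂ hy' => ?_⟩
    by_contra hne
    obtain ⟨a, b, ha, hb, hab, hyab⟩ := hy'
    have hne' : x₁ ≠ x₂ := by
      rintro rfl
      rw [← add_smul, hab, one_smul] at hyab
      exact hne hyab
    have hlt := hF.2 h₁ h₂ hne' ha hb hab
    rw [hyab] at hlt
    -- The tolerance is the strict convexity gap at y. An affine majorant of F is at least a F(x₁) +
    -- b F(x₂) at y, so it cannot come that close to F(y).
    obtain ⟨_, ⟨p, rfl⟩, hFp, hp⟩ := hy _ (sub_pos.2 hlt)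
    have e1 : F x₁ ≤ p.1 + p.2 x₁ := hFp ⟨x₁, h₁⟩
    have e2 : F x₂ ≤ p.1 + p.2 x₂ := hFp ⟨x₂, h₂⟩
    have e3 : p.1 + p.2 y < F y + (a • F x₁ + b • F x₂ - F y) := hp
    rw [← hyab, map_add, map_smul, map_smul] at e3
    simp only [smul_eq_mul] at e3
    have : p.1 = a * p.1 + b * p.1 := by rw [← add_mul, hab, one_mul]
    nlinarith [mul_le_mul_of_nonneg_left e1 ha.le, mul_le_mul_of_nonneg_left e2 hb.le]

end Choquet

/-! ### The compact convex set of traces and the dichotomy for traces -/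

section Traces

variable {G : Type*} [Group G]

/-- The Hermitian form on finite families attached to a function on `G`. -/
noncomputable def groupForm (φ : G → ℂ) {n : ℕ} (g : Fin n → G) (c : Fin n → ℂ) : ℂ :=
  ∑ i, ∑ j, star (c i) * (φ ((g i)⁻¹ * g j) * c j)

theorem groupForm_eq_dotProduct (φ : G → ℂ) {n : ℕ} (g : Fin n → G) (c : Fin n → ℂ) :
    groupForm φ g c =
      star c ⬝ᵥ (Matrix.of fun i j => φ ((g i)⁻¹ * g j)).mulVec c := by
  simp [groupForm, dotProduct, Matrix.mulVec, Finset.mul_sum]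

theorem IsPositiveDefinite.map_inv {φ : G → ℂ} (h : IsPositiveDefinite φ) (g : G) :
    φ g⁻¹ = star (φ g) := by
  have := (h 2 ![1, g]).isHermitian.apply 1 0
  simpa using this.symm

/-- Rewrites positive definiteness as pointwise conditions, closed and stable under convex
combinations of φ. -/
theorem isPositiveDefinite_iff {φ : G → ℂ} : IsPositiveDefinite φ ↔
    (∀ g, φ g⁻¹ = star (φ g)) ∧ ∀ (n : ℕ) (g : Fin n → G) (c : Fin n → ℂ), 0 ≤ groupForm φ g c := by
  refine ⟨fun h => ⟨h.map_inv, fun n g c => ?_⟩, fun h n g => ?_⟩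
  · rw [groupForm_eq_dotProduct]
    exact (h n g).dotProduct_mulVec_nonneg c
  · refine Matrix.PosSemidef.of_dotProduct_mulVec_nonneg ?_ fun c => ?_
    · ext i j
      simp only [Matrix.conjTranspose_apply, Matrix.of_apply]
      rw [← h.1]
      simp
    · rw [← groupForm_eq_dotProduct]
      exact h.2 n g c

/-- The 2 × 2 matrix of the pair (1, g) has determinant 1 - |φ(g)|². -/
theorem IsTrace.norm_le_one {φ : G → ℂ} (h : IsTrace φ) (g : G) : ‖φ g‖ ≤ 1 := by
  have h1 := (h.positiveDefinite 2 ![1, g]).det_nonneg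
  rw [Matrix.det_fin_two] at h1
  simp only [Matrix.of_apply, Matrix.cons_val_zero, Matrix.cons_val_one, inv_one, mul_one,
    inv_mul_cancel, one_mul, h.map_one, h.positiveDefinite.map_inv] at h1
  rw [Complex.star_def, Complex.mul_conj, Complex.normSq_eq_norm_sq] at h1
  have h2 : (0 : ℝ) ≤ 1 - ‖φ g‖ ^ 2 := by exact_mod_cast h1
  nlinarith [norm_nonneg (φ g)]

theorem isClosed_setOf_isTrace : IsClosed {φ : G → ℂ | IsTrace φ} := by
  have : {φ : G → ℂ | IsTrace φ} = {φ | ∀ g, φ g⁻¹ = star (φ g)} ∩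
      {φ | ∀ (n : ℕ) (g : Fin n → G) (c : Fin n → ℂ), 0 ≤ groupForm φ g c} ∩
      {φ | φ 1 = 1} ∩ {φ | ∀ g h, φ (g * h * g⁻¹) = φ h} := by
    ext φ
    refine ⟨fun h => ⟨⟨isPositiveDefinite_iff.1 h.1, h.2⟩, h.3⟩, fun h => ?_⟩
    exact ⟨isPositiveDefinite_iff.2 h.1.1, h.1.2, h.2⟩
  rw [this]
  simp only [Set.ofPred_forall, groupForm]
  refine (((isClosed_iInter fun g => isClosed_eq (by fun_prop) (by fun_prop)).inter
    (isClosed_iInter fun n => isClosed_iInter fun g => isClosed_iInter fun c =>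
      isClosed_le (by fun_prop) (by fun_prop))).inter
    (isClosed_eq (by fun_prop) (by fun_prop))).inter
    (isClosed_iInter fun g => isClosed_iInter fun h => isClosed_eq (by fun_prop) (by fun_prop))

theorem isCompact_setOf_isTrace : IsCompact {φ : G → ℂ | IsTrace φ} := by
  refine (isCompact_univ_pi fun _ : G => isCompact_closedBall (0 : ℂ) 1).of_isClosed_subset
    isClosed_setOf_isTrace fun φ hφ g _ => ?_
  simpa using hφ.norm_le_one g

theorem groupForm_add (φ ψ : G → ℂ) {n : ℕ} (g : Fin n → G) (c : Fin n → ℂ) :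
    groupForm (φ + ψ) g c = groupForm φ g c + groupForm ψ g c := by
  simp only [groupForm, Pi.add_apply, add_mul, mul_add, Finset.sum_add_distrib]

theorem groupForm_smul (a : ℝ) (ψ : G → ℂ) {n : ℕ} (g : Fin n → G) (c : Fin n → ℂ) :
    groupForm (a • ψ) g c = a * groupForm ψ g c := by
  simp only [groupForm, Pi.smul_apply, Complex.real_smul, Finset.mul_sum]
  refine Finset.sum_congr rfl fun i _ => Finset.sum_congr rfl fun j _ => by ring

theorem convex_setOf_isTrace : Convex ℝ {φ : G → ℂ | IsTrace φ} := by
  intro φ hφ ψ hψ a b ha hb hab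
  have h1 := isPositiveDefinite_iff.1 hφ.1
  have h2 := isPositiveDefinite_iff.1 hψ.1
  refine ⟨isPositiveDefinite_iff.2 ⟨fun g => ?_, fun n g c => ?_⟩, ?_, fun g h => ?_⟩
  · simp [h1.1, h2.1]
  · rw [groupForm_add, groupForm_smul, groupForm_smul]
    exact add_nonneg (mul_nonneg (by exact_mod_cast ha) (h1.2 n g c))
      (mul_nonneg (by exact_mod_cast hb) (h2.2 n g c))
  · simp only [Pi.add_apply, Pi.smul_apply, hφ.2, hψ.2, Complex.real_smul, mul_one]
    exact_mod_cast hab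
  · simp [hφ.3, hψ.3]

section Encodable

variable [Encodable G]

/-- A weighted `ℓ²` norm square of a function on a countable type. -/
noncomputable def weightedNormSq (φ : G → ℂ) : ℝ :=
  ∑' g : G, (1 / 2 : ℝ) ^ Encodable.encode g * ‖φ g‖ ^ 2

theorem IsTrace.weightedNormSq_term_le {φ : G → ℂ} (h : IsTrace φ) (g : G) :
    ‖(1 / 2 : ℝ) ^ Encodable.encode g * ‖φ g‖ ^ 2‖ ≤ (1 / 2 : ℝ) ^ Encodable.encode g := by
  rw [Real.norm_of_nonneg (by positivity)]
  exact mul_le_of_le_one_right (by positivity) (pow_le_one₀ (norm_nonneg _) (h.norm_le_one g))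

theorem IsTrace.summable_weightedNormSq {φ : G → ℂ} (h : IsTrace φ) :
    Summable fun g : G => (1 / 2 : ℝ) ^ Encodable.encode g * ‖φ g‖ ^ 2 :=
  summable_geometric_two_encode.of_norm_bounded h.weightedNormSq_term_le

theorem continuousOn_weightedNormSq :
    ContinuousOn (weightedNormSq (G := G)) {φ | IsTrace φ} :=
  continuousOn_tsum (fun g => by fun_prop) summable_geometric_two_encode
    fun g _ hφ => hφ.weightedNormSq_term_le g

theorem norm_combo_sq (z w : ℂ) {a b : ℝ} (hab : a + b = 1) :
    ‖a • z + b • w‖ ^ 2 = a * ‖z‖ ^ 2 + b * ‖w‖ ^ 2 - a * b * ‖z - w‖ ^ 2 := by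
  obtain rfl : b = 1 - a := by linarith
  simp only [← Complex.normSq_eq_norm_sq, Complex.normSq_apply]
  simp
  ring

/-- Each term is convex by `norm_combo_sq`, strictly so at any g where the two traces differ, and
every weight is positive. -/
theorem strictConvexOn_weightedNormSq :
    StrictConvexOn ℝ {φ | IsTrace φ} (weightedNormSq (G := G)) := by
  refine ⟨convex_setOf_isTrace, fun φ hφ ψ hψ hne a b ha hb hab => ?_⟩
  have hs := convex_setOf_isTrace hφ hψ ha.le hb.le hab
  obtain ⟨g, hg⟩ := Function.ne_iff.1 hne
  simp only [weightedNormSq, smul_eq_mul]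
  rw [← tsum_mul_left, ← tsum_mul_left,
    ← (hφ.summable_weightedNormSq.mul_left a).tsum_add (hψ.summable_weightedNormSq.mul_left b)]
  have key : ∀ g, (1 / 2 : ℝ) ^ Encodable.encode g * ‖(a • φ + b • ψ) g‖ ^ 2 =
      a * ((1 / 2 : ℝ) ^ Encodable.encode g * ‖φ g‖ ^ 2) +
      b * ((1 / 2 : ℝ) ^ Encodable.encode g * ‖ψ g‖ ^ 2) -
      (1 / 2 : ℝ) ^ Encodable.encode g * (a * b * ‖φ g - ψ g‖ ^ 2) := fun g => by
    rw [Pi.add_apply, Pi.smul_apply, Pi.smul_apply, norm_combo_sq _ _ hab]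
    ring
  refine Summable.tsum_lt_tsum (i := g) (fun g => ?_) ?_ hs.summable_weightedNormSq
    ((hφ.summable_weightedNormSq.mul_left a).add (hψ.summable_weightedNormSq.mul_left b))
  · simp only [key]
    have : 0 ≤ (1 / 2 : ℝ) ^ Encodable.encode g * (a * b * ‖φ g - ψ g‖ ^ 2) := by positivity
    linarith
  · simp only [key]
    have h0 : 0 < ‖φ g - ψ g‖ := norm_pos_iff.2 (sub_ne_zero.2 hg)
    have : 0 < (1 / 2 : ℝ) ^ Encodable.encode g * (a * b * ‖φ g - ψ g‖ ^ 2) := by positivity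
    linarith

end Encodable

/-- Every trace on a countable group is the barycenter of a probability measure on characters. -/
theorem IsTrace.exists_measure_isCharacter [Countable G] {φ : G → ℂ} (hφ : IsTrace φ) :
    ∃ m : Measure {ψ : G → ℂ | IsTrace ψ}, IsProbabilityMeasure m ∧
      (∀ L : (G → ℂ) →L[ℝ] ℝ, ∫ ψ : {ψ : G → ℂ | IsTrace ψ}, L ψ ∂m = L φ) ∧
      ∀ᵐ ψ : {ψ : G → ℂ | IsTrace ψ} ∂m, IsCharacter (ψ : G → ℂ) := by
  have := Encodable.ofCountable G
  exact exists_measure_extremePoints isCompact_setOf_isTrace continuousOn_weightedNormSq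
    strictConvexOn_weightedNormSq ⟨φ, hφ⟩

theorem countable_setOf_isFiniteDimensionalCharacter
    (hcount : HasCountablyManyFinDimUnitaryReps G) :
    {χ : G → ℂ | IsFiniteDimensionalCharacter χ}.Countable := by
  have : Countable (Σ n : ℕ, Quotient (unitaryEquivalence G n)) := hcount
  let f : (Σ n : ℕ, Quotient (unitaryEquivalence G n)) → G → ℂ := fun p =>
    Quotient.lift (s := unitaryEquivalence G p.1)
      (fun π g => (1 / (p.1 : ℂ)) * (π g : Matrix (Fin p.1) (Fin p.1) ℂ).trace) (by
        rintro π σ ⟨u, hu⟩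
        ext g
        rw [hu g]
        simp only [Submonoid.coe_mul]
        rw [Matrix.trace_mul_comm, ← mul_assoc, ← Submonoid.coe_mul, inv_mul_cancel]
        simp) p.2
  refine (Set.countable_range f).mono ?_
  rintro χ ⟨n, π, -, h⟩
  exact ⟨⟨n, Quotient.mk _ π⟩, funext fun g => (h g).symm⟩

/-- The real part of the Hermitian form, as a continuous real functional of the function. -/
noncomputable def groupFormRe {n : ℕ} (g : Fin n → G) (c : Fin n → ℂ) : (G → ℂ) →L[ℝ] ℝ where
  toFun φ := (groupForm φ g c).re
  map_add' φ ψ := by rw [groupForm_add, Complex.add_re]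
  map_smul' a φ := by rw [groupForm_smul, Complex.re_ofReal_mul]; rfl
  cont := by unfold groupForm; fun_prop

/-- The cases are decided by whether the representing measure has an atom at a finite-dimensional
character; countability makes the absence of such atoms mean measure zero. -/
theorem IsTrace.eq_zero_or_exists_isFiniteDimensionalCharacter [Countable G]
    (hrigid : IsCharacterRigid G) (hcount : HasCountablyManyFinDimUnitaryReps G)
    {φ : G → ℂ} (hφ : IsTrace φ) :
    (∀ g, g ∉ Subgroup.center G → φ g = 0) ∨
      ∃ χ : G → ℂ, IsTrace χ ∧ IsFiniteDimensionalCharacter χ ∧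
        ∃ a : ℝ, 0 < a ∧ IsPositiveDefinite (φ - a • χ) := by
  obtain ⟨m, hm, hL, hext⟩ := hφ.exists_measure_isCharacter
  have : CompactSpace {ψ : G → ℂ | IsTrace ψ} :=
    isCompact_iff_compactSpace.1 isCompact_setOf_isTrace
  have hi : ∀ L : (G → ℂ) →L[ℝ] ℝ,
      Integrable (fun ψ : {ψ : G → ℂ | IsTrace ψ} => L ψ) m := fun L =>
    (BoundedContinuousFunction.mkOfCompact
      ⟨fun ψ : {ψ : G → ℂ | IsTrace ψ} => L ψ, by fun_prop⟩).integrable m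
  by_cases h : ∃ χ : {ψ : G → ℂ | IsTrace ψ},
      IsFiniteDimensionalCharacter (χ : G → ℂ) ∧ m {χ} ≠ 0
  · right
    obtain ⟨χ, hχ, hne⟩ := h
    refine ⟨χ, χ.2, hχ, m.real {χ}, ENNReal.toReal_pos hne (measure_ne_top m _), ?_⟩
    have h1 := isPositiveDefinite_iff.1 hφ.1
    have h2 := isPositiveDefinite_iff.1 χ.2.1
    have e : φ - m.real {χ} • (χ : G → ℂ) = φ + (-m.real {χ}) • (χ : G → ℂ) := by
      rw [neg_smul, sub_eq_add_neg]
    refine isPositiveDefinite_iff.2 ⟨fun g => ?_, fun n g c => ?_⟩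
    · simp [h1.1, h2.1]
    · rw [e, groupForm_add, groupForm_smul, Complex.nonneg_iff]
      have i1 := (Complex.nonneg_iff.1 (h1.2 n g c)).2
      have i2 := (Complex.nonneg_iff.1 (h2.2 n g c)).2
      refine ⟨?_, by rw [Complex.add_im, Complex.im_ofReal_mul, ← i1, ← i2]; simp⟩
      rw [Complex.add_re, Complex.re_ofReal_mul]
      -- The form is nonnegative on every trace, so the contribution of the atom is at most the
      -- whole integral, which is the form of φ.
      have h3 : ∫ ψ in {χ}, groupFormRe g c ψ ∂m ≤ ∫ ψ, groupFormRe g c ψ ∂m :=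
        setIntegral_le_integral (hi _) (ae_of_all _ fun ψ =>
          (Complex.nonneg_iff.1 ((isPositiveDefinite_iff.1 ψ.2.1).2 n g c)).1)
      rw [hL, integral_singleton] at h3
      have h4 : m.real {χ} * (groupForm χ g c).re ≤ (groupForm φ g c).re := h3
      linarith
  · left
    push Not at h
    intro g hg
    have hc := (countable_setOf_isFiniteDimensionalCharacter hcount).preimage
      (Subtype.val_injective (p := (· ∈ {ψ : G → ℂ | IsTrace ψ})))
    have hnull : ∀ᵐ ψ : {ψ : G → ℂ | IsTrace ψ} ∂m,
        ¬ IsFiniteDimensionalCharacter (ψ : G → ℂ) := by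
      have h0 := (measure_biUnion_null_iff (μ := m) (s := fun ψ => {ψ}) hc).2 fun ψ hψ => h ψ hψ
      rw [ae_iff]
      refine measure_mono_null (fun ψ hψ => ?_) h0
      rw [Set.biUnion_of_singleton]
      exact not_not.1 hψ
    have hz : ∀ᵐ ψ : {ψ : G → ℂ | IsTrace ψ} ∂m, (ψ : G → ℂ) g = 0 := by
      filter_upwards [hext, hnull] with ψ h1 h2
      exact (hrigid _ h1).resolve_left h2 g hg
    have hre := hL (Complex.reCLM.comp (ContinuousLinearMap.proj (R := ℝ) (φ := fun _ : G => ℂ) g))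
    have him := hL (Complex.imCLM.comp (ContinuousLinearMap.proj (R := ℝ) (φ := fun _ : G => ℂ) g))
    rw [integral_eq_zero_of_ae (by filter_upwards [hz] with ψ h1; simp [h1])] at hre him
    exact Complex.ext (by simpa using hre.symm) (by simpa using him.symm)

end Traces

/-! ### Schur products and domination of the trivial character -/

section SchurProduct

/-- With W = ∑ cⱼ uⱼuⱼ*, the double sum is the squared Hilbert–Schmidt norm of W, and r ∑ cᵢ is its
trace. Cauchy–Schwarz on the diagonal compares the two. -/
theorem sq_sum_le_sum_norm_inner_sq {ι P : Type*} [Fintype ι] [Fintype P] (u : ι → P → ℂ) {r : ℝ}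
    (hu : ∀ i, ∑ p, ‖u i p‖ ^ 2 = r) (c : ι → ℝ) :
    (r * ∑ i, c i) ^ 2 ≤
      Fintype.card P * ∑ i, ∑ j, c i * c j * ‖∑ p, star (u i p) * u j p‖ ^ 2 := by
  let W : P → P → ℂ := fun p q => ∑ j, c j * (u j p * star (u j q))
  have hW : ∑ i, ∑ j, c i * c j * ‖∑ p, star (u i p) * u j p‖ ^ 2 = ∑ p, ∑ q, ‖W p q‖ ^ 2 := by
    have : (∑ i, ∑ j, c i * c j * ((‖∑ p, star (u i p) * u j p‖ : ℂ)) ^ 2) =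
        ∑ p, ∑ q, (‖W p q‖ : ℂ) ^ 2 := by
      have hcomm : ∀ T : ι → ι → P → P → ℂ,
          ∑ i, ∑ j, ∑ p, ∑ q, T i j p q = ∑ p, ∑ q, ∑ i, ∑ j, T i j p q := fun T => by
        refine (Finset.sum_congr rfl fun i _ => Finset.sum_comm).trans (Finset.sum_comm.trans ?_)
        exact Finset.sum_congr rfl fun p _ =>
          (Finset.sum_congr rfl fun i _ => Finset.sum_comm).trans Finset.sum_comm
      refine Eq.trans ?_ ((hcomm fun i j p q => c i * c j *
        (star (u i p) * u j p * (u i q * star (u j q)))).trans ?_)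
      · refine Finset.sum_congr rfl fun i _ => Finset.sum_congr rfl fun j _ => ?_
        rw [← Complex.mul_conj', map_sum, Finset.sum_mul_sum]
        simp [Finset.mul_sum]
      · refine Finset.sum_congr rfl fun p _ => Finset.sum_congr rfl fun q _ => ?_
        simp only [W]
        rw [← Complex.conj_mul', map_sum, Finset.sum_mul_sum]
        refine Finset.sum_congr rfl fun i _ => Finset.sum_congr rfl fun j _ => ?_
        simp only [map_mul, Complex.conj_ofReal, Complex.star_def, Complex.conj_conj]
        ring
    exact_mod_cast this
  have hdiag : ∀ p, W p p = ((∑ j, c j * ‖u j p‖ ^ 2 : ℝ) : ℂ) := fun p => by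
    simp [W, Complex.mul_conj']
  have hsum : r * ∑ i, c i = ∑ p, ∑ j, c j * ‖u j p‖ ^ 2 := by
    rw [Finset.sum_comm, Finset.mul_sum]
    refine Finset.sum_congr rfl fun j _ => ?_
    rw [← Finset.mul_sum, hu, mul_comm]
  rw [hW, hsum]
  refine sq_sum_le_card_mul_sum_sq.trans (mul_le_mul_of_nonneg_left ?_ (Nat.cast_nonneg _))
  refine Finset.sum_le_sum fun p _ => ?_
  refine le_trans (le_of_eq ?_) (Finset.single_le_sum (f := fun q => ‖W p q‖ ^ 2)
    (fun q _ => by positivity) (Finset.mem_univ p))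
  rw [hdiag, Complex.norm_real, Real.norm_eq_abs, sq_abs]

theorem sum_norm_sq_unitary {n : ℕ} (U : Matrix.unitaryGroup (Fin n) ℂ) :
    ∑ p : Fin n × Fin n, ‖(U : Matrix (Fin n) (Fin n) ℂ) p.1 p.2‖ ^ 2 = n := by
  have h : ((star (U : Matrix (Fin n) (Fin n) ℂ)) * U).trace = n := by
    rw [Matrix.UnitaryGroup.star_mul_self]
    simp
  have h2 : ((∑ p : Fin n × Fin n, ‖(U : Matrix (Fin n) (Fin n) ℂ) p.1 p.2‖ ^ 2 : ℝ) : ℂ) = n := by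
    rw [← h, Fintype.sum_prod_type, Finset.sum_comm]
    simp only [Matrix.trace, Matrix.diag_apply, Matrix.mul_apply, Matrix.star_apply,
      Complex.star_def, Complex.conj_mul', Complex.ofReal_sum, Complex.ofReal_pow]
  exact_mod_cast h2

variable {G : Type*} [Group G]

/-- Apply the preceding inequality to the n² matrix entries of π(gᵢ), whose squared norm is n; the
factors n² cancel. -/
theorem sq_sum_le_sum_norm_trace_sq {ι : Type*} [Fintype ι] {n : ℕ} (hn : n ≠ 0)
    (π : UnitaryRep G n) (g : ι → G) (c : ι → ℝ) :
    (∑ i, c i) ^ 2 ≤ ∑ i, ∑ j, c i * c j *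
      ‖(π ((g i)⁻¹ * g j) : Matrix (Fin n) (Fin n) ℂ).trace‖ ^ 2 := by
  have h := sq_sum_le_sum_norm_inner_sq
    (fun i (p : Fin n × Fin n) => (π (g i) : Matrix (Fin n) (Fin n) ℂ) p.1 p.2)
    (fun i => sum_norm_sq_unitary (π (g i))) c
  have ht : ∀ i j, (π ((g i)⁻¹ * g j) : Matrix (Fin n) (Fin n) ℂ).trace =
      ∑ p : Fin n × Fin n, star ((π (g i) : Matrix (Fin n) (Fin n) ℂ) p.1 p.2) *
        (π (g j) : Matrix (Fin n) (Fin n) ℂ) p.1 p.2 := fun i j => by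
    rw [Fintype.sum_prod_type, Finset.sum_comm, map_mul, map_inv]
    simp [Matrix.trace, Matrix.mul_apply, Matrix.star_apply]
  simp only [ht]
  rw [Fintype.card_prod, Fintype.card_fin, mul_pow, Nat.cast_mul, ← pow_two] at h
  exact le_of_mul_le_mul_left h (by positivity)

theorem IsPositiveDefinite.posSemidef {φ : G → ℂ} (h : IsPositiveDefinite φ) {ι : Type*}
    [Fintype ι] (g : ι → G) : (Matrix.of fun i j => φ ((g i)⁻¹ * g j)).PosSemidef := by
  have := (h _ (g ∘ (Fintype.equivFin ι).symm)).submatrix (Fintype.equivFin ι)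
  convert this using 1
  ext i j
  simp

/-- A positive definite function dominating a multiple of a finite-dimensional character has a
square that dominates a multiple of the trivial character. -/
theorem IsPositiveDefinite.exists_sq_sum_le {φ χ : G → ℂ} (hφ : IsPositiveDefinite φ)
    (hχ : IsTrace χ) (hfin : IsFiniteDimensionalCharacter χ) {a : ℝ} (ha : 0 < a)
    (hdom : IsPositiveDefinite (φ - a • χ)) :
    ∃ ε > 0, ∀ (s : Finset G) (c : G → ℝ),
      ε * (∑ g ∈ s, c g) ^ 2 ≤ ∑ g ∈ s, ∑ h ∈ s, c g * c h * ‖φ (g⁻¹ * h)‖ ^ 2 := by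
  obtain ⟨n, π, -, hπ⟩ := hfin
  have hn : n ≠ 0 := by
    rintro rfl
    have := hχ.map_one
    simp [hπ] at this
  refine ⟨(a / n) ^ 2, by positivity, fun s c => ?_⟩
  have hA := hφ.posSemidef (fun g : s => (g : G))
  have hC := hχ.1.posSemidef (fun g : s => (g : G))
  have hD := hdom.posSemidef (fun g : s => (g : G))
  -- This rests on |φ|² - a²|χ|² = (φ - aχ)φ̄ + aχ·conj(φ - aχ). Transposing a Hermitian matrix
  -- conjugates its entries.
  have hP := (hD.hadamard hA.transpose).add
    ((hC.hadamard hD.transpose).smul (show (0 : ℂ) ≤ (a : ℂ) by exact_mod_cast ha.le))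
  have h0 := hP.dotProduct_mulVec_nonneg (fun g : s => (c g : ℂ))
  have hentry : ∀ g h : s, (a : ℂ) * (χ ((g : G)⁻¹ * h) * (φ - a • χ) ((h : G)⁻¹ * g)) +
      (φ - a • χ) ((g : G)⁻¹ * h) * φ ((h : G)⁻¹ * g) =
      ((‖φ ((g : G)⁻¹ * h)‖ ^ 2 - a ^ 2 * ‖χ ((g : G)⁻¹ * h)‖ ^ 2 : ℝ) : ℂ) := fun g h => by
    have e1 : φ ((h : G)⁻¹ * g) = star (φ ((g : G)⁻¹ * h)) := by rw [← hφ.map_inv]; simp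
    have e2 : χ ((h : G)⁻¹ * g) = star (χ ((g : G)⁻¹ * h)) := by rw [← hχ.1.map_inv]; simp
    simp only [Pi.sub_apply, Pi.smul_apply, Complex.real_smul, e1, e2]
    push_cast
    rw [← Complex.mul_conj', ← Complex.mul_conj']
    simp only [Complex.star_def]
    ring
  have h1 : (0 : ℝ) ≤ ∑ g : s, ∑ h : s, c g * c h *
      (‖φ ((g : G)⁻¹ * h)‖ ^ 2 - a ^ 2 * ‖χ ((g : G)⁻¹ * h)‖ ^ 2) := by
    rw [← Complex.zero_le_real]
    refine h0.trans_eq ?_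
    simp only [dotProduct, Matrix.mulVec, Finset.mul_sum, Complex.ofReal_sum,
      Complex.ofReal_mul, ← hentry]
    refine Finset.sum_congr rfl fun g _ => Finset.sum_congr rfl fun h _ => ?_
    simp only [Pi.star_apply, Complex.star_def, Complex.conj_ofReal, Matrix.add_apply,
      Matrix.hadamard_apply, Matrix.smul_apply, Matrix.transpose_apply, Matrix.of_apply,
      smul_eq_mul]
    ring
  have h2 := sq_sum_le_sum_norm_trace_sq hn π (fun g : s => (g : G)) (fun g => c g)
  have h3 : ∀ g h : s, a ^ 2 * ‖χ ((g : G)⁻¹ * h)‖ ^ 2 =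
      (a / n) ^ 2 * ‖(π ((g : G)⁻¹ * h) : Matrix (Fin n) (Fin n) ℂ).trace‖ ^ 2 := fun g h => by
    rw [hπ]
    simp
    ring
  simp only [h3, mul_sub, Finset.sum_sub_distrib, sub_nonneg] at h1
  rw [← Finset.sum_coe_sort s c, ← Finset.sum_coe_sort s]
  simp only [← Finset.sum_coe_sort s (fun h => c _ * c h * _)]
  refine (mul_le_mul_of_nonneg_left h2 (by positivity)).trans (le_trans (le_of_eq ?_) h1)
  simp only [Finset.mul_sum]
  refine Finset.sum_congr rfl fun g _ => Finset.sum_congr rfl fun h _ => by ring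

end SchurProduct

/-! ### Near-minimizers of a quadratic form -/

section NearMinimizer

/-- Near-minimizers of a quadratic form on a convex set. -/
theorem exists_near_minimizer {V : Type*} [AddCommGroup V] [Module ℝ V] (B : V →ₗ[ℝ] V →ₗ[ℝ] ℝ)
    (hB : ∀ c d, B c d = B d c) {C : Set V} (hC : Convex ℝ C) (hne : C.Nonempty)
    (h01 : ∀ c ∈ C, ∀ d ∈ C, 0 ≤ B c d ∧ B c d ≤ 1) {ε : ℝ} (hε : ∀ c ∈ C, ε ≤ B c c)
    {τ : ℝ} (hτ : 0 < τ) :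
    ∃ c ∈ C, (∀ d ∈ C, B d d = B c c → B (d - c) (d - c) ≤ τ) ∧ ∀ d ∈ C, ε - τ ≤ B c d := by
  set m := sInf ((fun c => B c c) '' C) with hm
  have hbdd : BddBelow ((fun c => B c c) '' C) :=
    ⟨0, by rintro _ ⟨c, hc, rfl⟩; exact (h01 c hc c hc).1⟩
  have hmle : ∀ c ∈ C, m ≤ B c c := fun c hc => csInf_le hbdd ⟨c, hc, rfl⟩
  obtain ⟨t, ht0, ht1, htτ⟩ : ∃ t : ℝ, 0 < t ∧ t ≤ 1 ∧ t ≤ τ / 2 :=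
    ⟨min 1 (τ / 2), by positivity, min_le_left _ _, min_le_right _ _⟩
  obtain ⟨κ, hκ0, hκ1, hκ2⟩ : ∃ κ : ℝ, 0 < κ ∧ κ ≤ τ / 4 ∧ κ ≤ t * τ :=
    ⟨min (τ / 4) (t * τ), by positivity, min_le_left _ _, min_le_right _ _⟩
  obtain ⟨_, ⟨c, hc, rfl⟩, hlt⟩ := exists_lt_of_csInf_lt (hne.image _)
    (show m < m + κ by linarith)
  simp only at hlt
  refine ⟨c, hc, fun d hd hdc => ?_, fun d hd => ?_⟩
  -- Parallelogram identity: c and d both have energy below m + κ and their midpoint at least m, so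
  -- B(d - c, d - c) ≤ 4κ ≤ τ.
  · have h1 := hmle _ (hC hc hd (by norm_num : (0 : ℝ) ≤ 1 / 2) (by norm_num : (0 : ℝ) ≤ 1 / 2)
      (by norm_num))
    simp only [map_add, map_smul, map_sub, LinearMap.add_apply, LinearMap.smul_apply,
      LinearMap.sub_apply, smul_eq_mul] at h1 ⊢
    have := hB c d
    linarith
  -- First variation: moving from c a distance t towards d lowers the energy by at most κ ≤ tτ.
  -- Dividing by t gives B(c, d) ≥ B(c, c) - τ/2 - t.
  · have h1 := hmle _ (hC hc hd (sub_nonneg.2 ht1) ht0.le (by ring))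
    simp only [map_add, map_smul, LinearMap.add_apply, LinearMap.smul_apply, smul_eq_mul] at h1
    rw [hB d c] at h1
    have h2 := (h01 c hc d hd).1
    have h3 := (h01 c hc c hc).2
    have h4 := (h01 d hd d hd).2
    have h5 := hε c hc
    have h6 : 0 ≤ t * (τ + 2 * (B c d - B c c) + 2 * t) := by
      nlinarith [mul_nonneg ht0.le ht0.le, mul_nonneg (mul_nonneg ht0.le ht0.le) h2]
    have h7 := nonneg_of_mul_nonneg_right h6 ht0
    linarith

end NearMinimizer

/-! ### Probability vectors pushed to orbits -/

section OrbitForm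

/-- Finitely supported probability vectors on `α`. -/
def probVectors (α : Type*) : Set (α →₀ ℝ) := {c | (∀ g, 0 ≤ c g) ∧ ∑ g ∈ c.support, c g = 1}

theorem convex_probVectors {α : Type*} : Convex ℝ (probVectors α) := by
  have h : ∀ c : α →₀ ℝ, ∑ g ∈ c.support, c g = Finsupp.lsum ℝ (fun _ : α => (LinearMap.id : ℝ →ₗ[ℝ] ℝ)) c :=
    fun c => rfl
  intro c hc d hd a b ha hb hab
  refine ⟨fun g => ?_, ?_⟩
  · have := hc.1 g
    have := hd.1 g
    simp only [Finsupp.add_apply, Finsupp.smul_apply, smul_eq_mul]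
    positivity
  · rw [h, map_add, map_smul, map_smul, ← h, ← h, hc.2, hd.2]
    simpa using hab

theorem single_mem_probVectors {α : Type*} (g : α) : Finsupp.single g (1 : ℝ) ∈ probVectors α := by
  classical
  refine ⟨fun h => ?_, ?_⟩
  · rw [Finsupp.single_apply]
    split_ifs <;> norm_num
  · exact Finsupp.sum_single_index (h := fun _ a => a) rfl

theorem sum_mapDomain {α β : Type*} (f : α → β) (c : α →₀ ℝ) :
    ∑ y ∈ (c.mapDomain f).support, c.mapDomain f y = ∑ g ∈ c.support, c g :=
  Finsupp.sum_mapDomain_index (h := fun _ a => a) (fun _ => rfl) (fun _ _ _ => rfl)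

theorem mapDomain_mem_probVectors {α β : Type*} (f : α → β) {c : α →₀ ℝ} (hc : c ∈ probVectors α) :
    c.mapDomain f ∈ probVectors β := by
  classical
  refine ⟨fun y => ?_, by rw [sum_mapDomain, hc.2]⟩
  rw [Finsupp.mapDomain, Finsupp.sum_apply]
  refine Finset.sum_nonneg fun g _ => ?_
  simp only
  rw [Finsupp.single_apply]
  split_ifs
  exacts [hc.1 g, le_rfl]

theorem sum_le_one_of_mem_probVectors {α : Type*} {c : α →₀ ℝ} (hc : c ∈ probVectors α)
    (s : Finset α) : ∑ g ∈ s, c g ≤ 1 := by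
  classical
  rw [← hc.2]
  calc ∑ g ∈ s, c g ≤ ∑ g ∈ s ∪ c.support, c g :=
        Finset.sum_le_sum_of_subset_of_nonneg Finset.subset_union_left fun g _ _ => hc.1 g
    _ = ∑ g ∈ c.support, c g := by
        refine (Finset.sum_subset Finset.subset_union_right fun g _ hg => ?_).symm
        simpa using hg

variable {G : Type*} [Group G]

/-- The bilinear form on finitely supported functions attached to a real function on `G`. -/
noncomputable def realForm (p : G → ℝ) : (G →₀ ℝ) →ₗ[ℝ] (G →₀ ℝ) →ₗ[ℝ] ℝ :=
  Finsupp.lsum ℝ fun g => LinearMap.toSpanSingleton ℝ _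
    (Finsupp.lsum ℝ fun h => LinearMap.toSpanSingleton ℝ ℝ (p (g⁻¹ * h)))

theorem realForm_apply (p : G → ℝ) (c d : G →₀ ℝ) :
    realForm p c d = ∑ g ∈ c.support, ∑ h ∈ d.support, c g * d h * p (g⁻¹ * h) := by
  simp only [realForm, Finsupp.lsum_apply, Finsupp.sum, LinearMap.toSpanSingleton_apply,
    LinearMap.sum_apply, LinearMap.smul_apply, smul_eq_mul, Finset.mul_sum, mul_assoc]

theorem realForm_symm {p : G → ℝ} (hp : ∀ g, p g⁻¹ = p g) (c d : G →₀ ℝ) :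
    realForm p c d = realForm p d c := by
  rw [realForm_apply, realForm_apply, Finset.sum_comm]
  refine Finset.sum_congr rfl fun h _ => Finset.sum_congr rfl fun g _ => ?_
  rw [← hp (g⁻¹ * h), mul_inv_rev, inv_inv]
  ring

theorem realForm_mapDomain (p : G → ℝ) (s : G) (c : G →₀ ℝ) :
    realForm p (c.mapDomain (s * ·)) (c.mapDomain (s * ·)) = realForm p c c := by
  have : ∀ d : G →₀ ℝ, ∀ e : G →₀ ℝ, realForm p d e =
      d.sum fun g a => e.sum fun h b => a * b * p (g⁻¹ * h) := realForm_apply p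
  rw [this, this, Finsupp.sum_mapDomain_index (by simp)
    (by intros; simp only [add_mul, Finsupp.sum_add])]
  refine Finset.sum_congr rfl fun g _ => ?_
  simp only
  rw [Finsupp.sum_mapDomain_index (by simp) (by intros; ring)]
  refine Finset.sum_congr rfl fun h _ => by simp [mul_assoc]

theorem realForm_mem_Icc {p : G → ℝ} (hp : ∀ g, 0 ≤ p g ∧ p g ≤ 1) {c d : G →₀ ℝ}
    (hc : c ∈ probVectors G) (hd : d ∈ probVectors G) :
    0 ≤ realForm p c d ∧ realForm p c d ≤ 1 := by
  rw [realForm_apply]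
  refine ⟨Finset.sum_nonneg fun g _ => Finset.sum_nonneg fun h _ =>
    mul_nonneg (mul_nonneg (hc.1 g) (hd.1 h)) (hp _).1, ?_⟩
  calc ∑ g ∈ c.support, ∑ h ∈ d.support, c g * d h * p (g⁻¹ * h)
      ≤ ∑ g ∈ c.support, ∑ h ∈ d.support, c g * d h :=
        Finset.sum_le_sum fun g _ => Finset.sum_le_sum fun h _ =>
          mul_le_of_le_one_right (mul_nonneg (hc.1 g) (hd.1 h)) (hp _).2
    _ = 1 := by rw [← Finset.sum_mul_sum, hc.2, hd.2, one_mul]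

variable {X : Type*} [MulAction G X]

/-- The push-forward of `c` to the orbit of `x`. -/
noncomputable def orbitPush (x : X) (c : G →₀ ℝ) : X →₀ ℝ := c.mapDomain (· • x)

/-- The inner product of the push-forwards of `c` and `d` to the orbit of `x`. -/
noncomputable def orbitForm (x : X) (c d : G →₀ ℝ) : ℝ :=
  ∑ g ∈ c.support, c g * orbitPush x d (g • x)

/-- The terms g and h land on the same point of the orbit exactly when g⁻¹h fixes x. Integrating in
x thus produces `realForm (fixedMeasure μ)`. -/
theorem orbitForm_eq_sum (x : X) (c d : G →₀ ℝ) :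
    orbitForm x c d =
      ∑ g ∈ c.support, ∑ h ∈ d.support,
        c g * d h * (MulAction.fixedBy X (g⁻¹ * h)).indicator 1 x := by
  classical
  refine Finset.sum_congr rfl fun g _ => ?_
  rw [orbitPush, Finsupp.mapDomain, Finsupp.sum_apply, Finsupp.sum, Finset.mul_sum]
  refine Finset.sum_congr rfl fun h _ => ?_
  have hiff : x ∈ MulAction.fixedBy X (g⁻¹ * h) ↔ h • x = g • x := by
    rw [MulAction.mem_fixedBy, mul_smul, inv_smul_eq_iff]
  by_cases hx : h • x = g • x
  · rw [Set.indicator_of_mem (hiff.2 hx), Finsupp.single_apply, if_pos hx]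
    simp
  · rw [Set.indicator_of_notMem (mt hiff.1 hx), Finsupp.single_apply, if_neg hx]
    simp

theorem orbitForm_single_one (x : X) (c : G →₀ ℝ) :
    orbitForm x (Finsupp.single 1 1) c = orbitPush x c x := by
  have := Finsupp.sum_single_index (a := (1 : G)) (b := (1 : ℝ))
    (h := fun g a => a * orbitPush x c (g • x)) (by simp)
  refine Eq.trans this ?_
  simp

theorem sq_orbitPush_le (x : X) (c : G →₀ ℝ) (y : X) : orbitPush x c y ^ 2 ≤ orbitForm x c c := by
  have h : orbitForm x c c = ∑ y ∈ (orbitPush x c).support, orbitPush x c y * orbitPush x c y :=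
    (Finsupp.sum_mapDomain_index (f := (· • x)) (s := c) (h := fun y a => a * orbitPush x c y)
      (by simp) (by intros; ring)).symm
  rw [h]
  by_cases hy : y ∈ (orbitPush x c).support
  · rw [pow_two]
    exact Finset.single_le_sum (f := fun y => orbitPush x c y * orbitPush x c y)
      (fun y _ => mul_self_nonneg _) hy
  · rw [Finsupp.notMem_support_iff.1 hy]
    simpa using Finset.sum_nonneg fun y _ => mul_self_nonneg (orbitPush x c y)

/-- Turns variation along the orbit into a value at x of one pushed vector, which `sq_orbitPush_le`
controls by its energy. -/
theorem orbitPush_translate_sub (x : X) (c : G →₀ ℝ) (s : G) :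
    orbitPush x (c.mapDomain (s⁻¹ * ·) - c) x = orbitPush x c (s • x) - orbitPush x c x := by
  have h1 : orbitPush x (c.mapDomain (s⁻¹ * ·) - c) =
      orbitPush x (c.mapDomain (s⁻¹ * ·)) - orbitPush x c :=
    map_sub (Finsupp.mapDomain.addMonoidHom (· • x)) _ _
  have h2 : orbitPush x (c.mapDomain (s⁻¹ * ·)) =
      (orbitPush x c).mapDomain (s⁻¹ • · : X → X) := by
    simp only [orbitPush, ← Finsupp.mapDomain_comp]
    congr 1
    ext g
    simp [mul_smul]
  rw [h1, Finsupp.sub_apply, h2]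
  congr 1
  have := Finsupp.mapDomain_apply (MulAction.injective (s⁻¹ : G)) (orbitPush x c) (s • x)
  simpa using this

/-- If `S` moves `x` to at least `N` points, then an almost invariant probability vector gives
mass at most about `1 / N` to `x`. -/
theorem card_mul_orbitPush_le [DecidableEq X] (x : X) {c : G →₀ ℝ} (hc : c ∈ probVectors G)
    (S : Finset G) :
    (S.image (· • x)).card * orbitPush x c x ≤
      1 + ∑ s ∈ S, |orbitPush x c (s • x) - orbitPush x c x| := by
  have h1 := sum_le_one_of_mem_probVectors (mapDomain_mem_probVectors (· • x) hc) (S.image (· • x))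
  have h2 : ∑ y ∈ S.image (· • x), |orbitPush x c y - orbitPush x c x| ≤
      ∑ s ∈ S, |orbitPush x c (s • x) - orbitPush x c x| :=
    Finset.sum_image_le_of_nonneg (f := fun y => |orbitPush x c y - orbitPush x c x|)
      fun _ _ => abs_nonneg _
  calc ((S.image (· • x)).card : ℝ) * orbitPush x c x
      = ∑ y ∈ S.image (· • x), orbitPush x c x := by simp
    _ ≤ ∑ y ∈ S.image (· • x),
        (orbitPush x c y + |orbitPush x c y - orbitPush x c x|) := by
        refine Finset.sum_le_sum fun y _ => ?_
        have := neg_abs_le (orbitPush x c y - orbitPush x c x)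
        linarith
    _ ≤ _ := by
        rw [Finset.sum_add_distrib]
        exact add_le_add h1 h2

end OrbitForm

/-! ### Fixed point sets -/

section FixedMeasure

/-- The matrix involved is the Gram matrix of the point masses at gᵢ • x. -/
theorem groupForm_indicator_fixedBy_nonneg {G X : Type*} [Group G] [MulAction G X]
    (x : X) {n : ℕ} (g : Fin n → G) (c : Fin n → ℂ) :
    0 ≤ groupForm (fun h => (MulAction.fixedBy X h).indicator (1 : X → ℂ) x) g c := by
  classical
  have hsub := ((Matrix.PosSemidef.one (n := X) (R := ℂ)).submatrix
    (fun i => g i • x)).dotProduct_mulVec_nonneg c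
  rw [groupForm_eq_dotProduct]
  refine hsub.trans_eq ?_
  congr 2
  ext i j
  have hiff : x ∈ MulAction.fixedBy X ((g i)⁻¹ * g j) ↔ g i • x = g j • x := by
    rw [MulAction.mem_fixedBy, mul_smul, inv_smul_eq_iff, eq_comm]
  by_cases hx : g i • x = g j • x
  · simp [Set.indicator_of_mem (hiff.2 hx), Matrix.one_apply, hx]
  · simp [Set.indicator_of_notMem (mt hiff.1 hx), hx]

variable {G X : Type*} [Group G] [MulAction G X] [MeasurableSpace X] (μ : Measure X)

/-- The measure of the fixed point set of a group element. -/
noncomputable def fixedMeasure (g : G) : ℝ := μ.real (MulAction.fixedBy X g)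

theorem fixedMeasure_mem_Icc [IsProbabilityMeasure μ] (g : G) :
    0 ≤ fixedMeasure μ g ∧ fixedMeasure μ g ≤ 1 :=
  ⟨measureReal_nonneg, measureReal_le_one⟩

theorem fixedMeasure_inv (g : G) : fixedMeasure μ g⁻¹ = fixedMeasure μ g := by
  simp [fixedMeasure]

end FixedMeasure

/-! ### From the energy bound to finite orbits and transitivity -/

section Action

variable {G X : Type*} [Group G] [MulAction G X] [MeasurableSpace X] [StandardBorelSpace X]
  [MeasurableConstSMul G X]

theorem measurableSet_smul_eq_smul (g h : G) : MeasurableSet {x : X | g • x = h • x} :=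
  measurableSet_eq_fun (measurable_const_smul g) (measurable_const_smul h)

theorem measurableSet_fixedBy (g : G) : MeasurableSet (MulAction.fixedBy X g) :=
  measurableSet_eq_fun (measurable_const_smul g) measurable_id

theorem measurableSet_le_card_image [DecidableEq X] (S : Finset G) (N : ℕ) :
    MeasurableSet {x : X | N ≤ (S.image (· • x)).card} := by
  classical
  have : {x : X | N ≤ (S.image (· • x)).card} =
      ⋃ T ∈ S.powersetCard N, ⋂ g ∈ T, ⋂ h ∈ T, {x : X | g • x = h • x → g = h} := by
    ext x
    simp only [Set.mem_ofPred_eq, Set.mem_iUnion, Set.mem_iInter, Finset.mem_powersetCard,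
      exists_prop]
    constructor
    · intro hN
      obtain ⟨t, ht, hcard⟩ := Finset.exists_subset_card_eq hN
      have hsurj : Set.SurjOn (· • x) (S : Set G) (t : Set X) := fun y hy => by
        simpa using ht hy
      obtain ⟨T, hTS, hinj, rfl⟩ := Finset.exists_subset_injOn_image_eq_of_surjOn _ t hsurj
      exact ⟨T, ⟨Finset.coe_subset.1 hTS, by rw [← hcard, Finset.card_image_of_injOn hinj]⟩,
        fun g hg h hh e => hinj hg hh e⟩
    · rintro ⟨T, ⟨hTS, rfl⟩, hinj⟩
      rw [← Finset.card_image_of_injOn (f := (· • x)) (s := T) fun g hg h hh e => hinj g hg h hh e]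
      exact Finset.card_le_card (Finset.image_subset_image hTS)
  rw [this]
  refine Finset.measurableSet_biUnion _ fun T _ => Finset.measurableSet_biInter _ fun g _ =>
    Finset.measurableSet_biInter _ fun h _ => ?_
  by_cases e : g = h
  · simp [e]
  · simp only [e, imp_false]
    exact (measurableSet_smul_eq_smul g h).compl

variable (μ : Measure X) [IsProbabilityMeasure μ]

theorem integrable_indicator_fixedBy (g : G) :
    Integrable (fun x => (MulAction.fixedBy X g).indicator (1 : X → ℝ) x) μ :=
  (integrable_const (1 : ℝ)).indicator (measurableSet_fixedBy g)

theorem integrable_orbitForm (c d : G →₀ ℝ) : Integrable (fun x : X => orbitForm x c d) μ := by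
  simp only [orbitForm_eq_sum]
  exact integrable_finsetSum _ fun g _ => integrable_finsetSum _ fun h _ =>
    (integrable_indicator_fixedBy μ _).const_mul _

theorem integral_orbitForm (c d : G →₀ ℝ) :
    ∫ x : X, orbitForm x c d ∂μ = realForm (fixedMeasure μ) c d := by
  simp only [orbitForm_eq_sum, realForm_apply]
  rw [integral_finsetSum _ fun g _ => integrable_finsetSum _ fun h _ =>
    (integrable_indicator_fixedBy μ _).const_mul _]
  refine Finset.sum_congr rfl fun g _ => ?_
  rw [integral_finsetSum _ fun h _ => (integrable_indicator_fixedBy μ _).const_mul _]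
  refine Finset.sum_congr rfl fun h _ => ?_
  rw [integral_const_mul, integral_indicator_one (measurableSet_fixedBy _), fixedMeasure]

/-- The sets increase with S, and their union contains every point with infinite orbit. -/
theorem exists_finset_lt_measure_card_image [DecidableEq X] [Countable G]
    (hinf : ∀ᵐ x ∂μ, (MulAction.orbit G x).Infinite) (N : ℕ) {ε : ℝ} (hε : 0 < ε) :
    ∃ S : Finset G, μ.real {x : X | N ≤ (S.image (· • x)).card}ᶜ < ε := by
  have hdir : Directed (· ⊆ ·) fun S : Finset G => {x : X | N ≤ (S.image (· • x)).card} := by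
    refine Monotone.directed_le fun S T hST x (hx : N ≤ _) => ?_
    exact hx.trans (Finset.card_le_card (Finset.image_subset_image hST))
  have hU : μ (⋃ S : Finset G, {x : X | N ≤ (S.image (· • x)).card}) = 1 := by
    refine (measure_congr (Filter.eventuallyEq_univ.2 ?_)).trans measure_univ
    filter_upwards [hinf] with x hx
    obtain ⟨t, ht, hcard⟩ := hx.exists_subset_card_eq N
    rw [MulAction.orbit, ← Set.image_univ, Finset.subset_set_image_iff] at ht
    obtain ⟨S, -, rfl⟩ := ht
    exact Set.mem_iUnion.2 ⟨S, hcard.ge⟩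
  rw [hdir.measure_iUnion] at hU
  have hlt : 1 - ENNReal.ofReal ε < ⨆ S : Finset G, μ {x : X | N ≤ (S.image (· • x)).card} := by
    rw [hU]
    exact ENNReal.sub_lt_self ENNReal.one_ne_top one_ne_zero (by simpa using hε)
  obtain ⟨S, hS⟩ := lt_iSup_iff.1 hlt
  refine ⟨S, ?_⟩
  rw [probReal_compl_eq_one_sub (measurableSet_le_card_image S N)]
  by_contra! hcon
  refine hS.not_ge ?_
  rw [← ofReal_measureReal, ← ENNReal.ofReal_one, ← ENNReal.ofReal_sub _ hε.le]
  exact ENNReal.ofReal_le_ofReal (by linarith)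

/-- A uniform lower bound for the form on probability vectors forces finite orbits. -/
theorem not_ae_infinite_orbit [Countable G] {ε : ℝ} (hε : 0 < ε)
    (hle : ∀ c ∈ probVectors G, ε ≤ realForm (fixedMeasure μ) c c) :
    ¬ ∀ᵐ x ∂μ, (MulAction.orbit G x).Infinite := by
  classical
  intro hinf
  -- Error budget for the mean mass at the base point: ε/4 from points with few translates, ε/4 from
  -- 1/N, ε/8 from non-invariance. The total 5ε/8 contradicts the lower bound ε - τ ≥ 7ε/8.
  obtain ⟨N, hN⟩ := exists_nat_gt (4 / ε)
  have hN0 : (0 : ℝ) < N := (by positivity : (0 : ℝ) < 4 / ε).trans hN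
  have hN1 : (1 : ℝ) ≤ N := by exact_mod_cast hN0
  have hN2 : 1 / (N : ℝ) < ε / 4 := by
    rw [div_lt_iff₀ hε] at hN
    rw [div_lt_iff₀ hN0]
    linarith
  obtain ⟨S, hS⟩ := exists_finset_lt_measure_card_image μ hinf N (show 0 < ε / 4 by positivity)
  set E := {x : X | N ≤ (S.image (· • x)).card} with hE
  have hEm : MeasurableSet E := measurableSet_le_card_image S N
  set k : ℝ := (S.card : ℝ) with hk
  have hk0 : 0 ≤ k := Nat.cast_nonneg _
  obtain ⟨δ, hδ0, hδ⟩ : ∃ δ : ℝ, 0 < δ ∧ k * δ ≤ ε / 16 :=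
    ⟨ε / 16 / (k + 1), by positivity, by
      rw [mul_div_assoc', div_le_iff₀ (by positivity)]
      nlinarith⟩
  obtain ⟨τ, hτ0, hτ1, hτ2⟩ : ∃ τ : ℝ, 0 < τ ∧ τ ≤ ε / 8 ∧ k * (τ / δ) ≤ ε / 16 := by
    refine ⟨min (ε / 8) (δ ^ 2), by positivity, min_le_left _ _, le_trans ?_ hδ⟩
    refine mul_le_mul_of_nonneg_left ?_ hk0
    rw [div_le_iff₀ hδ0, ← pow_two]
    exact min_le_right _ _
  obtain ⟨c, hc, hc1, hc2⟩ := exists_near_minimizer (realForm (fixedMeasure μ))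
    (realForm_symm (fixedMeasure_inv μ)) convex_probVectors ⟨_, single_mem_probVectors (1 : G)⟩
    (fun c hc d hd => realForm_mem_Icc (fixedMeasure_mem_Icc μ) hc hd) hle hτ0
  have hlow := hc2 _ (single_mem_probVectors (1 : G))
  rw [realForm_symm (fixedMeasure_inv μ), ← integral_orbitForm] at hlow
  let D : G → G →₀ ℝ := fun s => c.mapDomain (s⁻¹ * ·) - c
  have hD : ∀ s, ∫ x : X, orbitForm x (D s) (D s) ∂μ ≤ τ := fun s => by
    rw [integral_orbitForm]
    exact hc1 _ (mapDomain_mem_probVectors _ hc) (realForm_mapDomain _ _ _)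
  have hpt : ∀ x : X, orbitForm x (Finsupp.single 1 1) c ≤
      Eᶜ.indicator 1 x + (1 / N + ∑ s ∈ S, (δ + orbitForm x (D s) (D s) / δ)) := fun x => by
    rw [orbitForm_single_one]
    have hpos : ∀ s ∈ S, 0 ≤ orbitForm x (D s) (D s) / δ := fun s _ =>
      div_nonneg ((sq_nonneg _).trans (sq_orbitPush_le x (D s) x)) hδ0.le
    by_cases hx : x ∈ E
    · rw [Set.indicator_of_notMem (by simpa using hx), zero_add]
      have h1 := card_mul_orbitPush_le x hc S
      have h0 : 0 ≤ orbitPush x c x := (mapDomain_mem_probVectors (· • x) hc).1 x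
      have h2 : (N : ℝ) * orbitPush x c x ≤ (S.image (· • x)).card * orbitPush x c x :=
        mul_le_mul_of_nonneg_right (by exact_mod_cast hx) h0
      have h3 : ∑ s ∈ S, |orbitPush x c (s • x) - orbitPush x c x| ≤
          ∑ s ∈ S, (δ + orbitForm x (D s) (D s) / δ) := by
        refine Finset.sum_le_sum fun s _ => ?_
        have h4 := sq_orbitPush_le x (D s) x
        rw [orbitPush_translate_sub] at h4
        set u := orbitPush x c (s • x) - orbitPush x c x
        -- Only u² has a small integral, at most τ; this linearization bounds the mean of |u| by δ +
        -- τ/δ.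
        have h5 : |u| ≤ δ + u ^ 2 / δ := by
          rw [← sub_le_iff_le_add', le_div_iff₀ hδ0, ← sq_abs u]
          nlinarith [sq_nonneg (|u| - δ), abs_nonneg u]
        refine h5.trans ?_
        gcongr
      have h6 : 0 ≤ ∑ s ∈ S, (δ + orbitForm x (D s) (D s) / δ) :=
        Finset.sum_nonneg fun s hs => add_nonneg hδ0.le (hpos s hs)
      calc orbitPush x c x = (N * orbitPush x c x) / N := by field_simp
        _ ≤ (1 + ∑ s ∈ S, (δ + orbitForm x (D s) (D s) / δ)) / N := by
            gcongr
            linarith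
        _ ≤ _ := by
            rw [add_div]
            gcongr
            exact div_le_self h6 hN1
    · rw [Set.indicator_of_mem (by simpa using hx)]
      have h1 := sum_le_one_of_mem_probVectors (mapDomain_mem_probVectors (· • x) hc) {x}
      rw [Finset.sum_singleton] at h1
      have h2 : (0 : ℝ) ≤ 1 / N + ∑ s ∈ S, (δ + orbitForm x (D s) (D s) / δ) :=
        add_nonneg (by positivity)
          (Finset.sum_nonneg fun s hs => add_nonneg hδ0.le (hpos s hs))
      have h3 : orbitPush x c x ≤ 1 := h1
      simp only [Pi.one_apply]
      linarith
  have hi1 : Integrable (fun x => Eᶜ.indicator (1 : X → ℝ) x) μ :=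
    (integrable_const (1 : ℝ)).indicator hEm.compl
  have hi2 : ∀ s ∈ S, Integrable (fun x : X => δ + orbitForm x (D s) (D s) / δ) μ := fun s _ =>
    (integrable_const _).add ((integrable_orbitForm μ _ _).div_const _)
  have hi3 := integrable_finsetSum S hi2
  have hi4 : Integrable (fun x : X => 1 / (N : ℝ) +
      ∑ s ∈ S, (δ + orbitForm x (D s) (D s) / δ)) μ := (integrable_const _).add hi3
  have hup := integral_mono (integrable_orbitForm μ _ _)
    (hi1.add hi4) hpt
  have hI : ∫ x, (Eᶜ.indicator (1 : X → ℝ) x +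
      (1 / N + ∑ s ∈ S, (δ + orbitForm x (D s) (D s) / δ))) ∂μ ≤
      μ.real Eᶜ + (1 / N + ∑ s ∈ S, (δ + τ / δ)) := by
    rw [integral_add hi1 hi4,
      integral_add (integrable_const _) hi3, integral_indicator_one hEm.compl,
      integral_finsetSum _ hi2]
    simp only [integral_const, probReal_univ, one_smul]
    gcongr with s hs
    rw [integral_add (integrable_const _) ((integrable_orbitForm μ _ _).div_const _),
      integral_div]
    simp only [integral_const, probReal_univ, one_smul]
    gcongr
    exact hD s
  rw [Finset.sum_const, nsmul_eq_mul, ← hk, mul_add] at hI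
  have := hup.trans hI
  linarith

/-- An ergodic action with a non-null set of finite orbits is essentially transitive. -/
theorem isEssentiallyTransitive_of_finite_orbits [Countable G] [ErgodicSMul G X μ]
    (hfin : ¬ ∀ᵐ x ∂μ, (MulAction.orbit G x).Infinite) : IsEssentiallyTransitive G μ := by
  let := upgradeStandardBorel X
  have hcb := TopologicalSpace.countable_countableBasis X
  have hdich : ∀ U ∈ TopologicalSpace.countableBasis X,
      (∀ᵐ x ∂μ, ∃ g : G, g • x ∈ U) ∨ ∀ᵐ x ∂μ, ¬ ∃ g : G, g • x ∈ U := by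
    intro U hU
    have hUm : MeasurableSet U := (TopologicalSpace.isOpen_of_mem_countableBasis hU).measurableSet
    have hm : MeasurableSet {x : X | ∃ g : G, g • x ∈ U} := by
      rw [show {x : X | ∃ g : G, g • x ∈ U} = ⋃ g : G, (g • ·) ⁻¹' U by ext; simp]
      exact MeasurableSet.iUnion fun g => measurable_const_smul g hUm
    have hinv : ∀ h : G, (h • ·) ⁻¹' {x : X | ∃ g : G, g • x ∈ U} =ᵐ[μ]
        {x : X | ∃ g : G, g • x ∈ U} := fun h => by
      refine Filter.EventuallyEq.of_eq (Set.ext fun x => ⟨?_, ?_⟩)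
      · rintro ⟨g, hg⟩
        exact ⟨g * h, by rwa [mul_smul]⟩
      · rintro ⟨g, hg⟩
        exact ⟨g * h⁻¹, by simpa [mul_smul] using hg⟩
    have := aeconst_of_forall_preimage_smul_ae_eq G hm.nullMeasurableSet hinv
    rw [Filter.eventuallyConst_set] at this
    exact this
  -- By ergodicity almost all orbits meet the same basic open sets, hence have the same closure. A
  -- finite orbit among them is closed, so it contains almost every point.
  have hZ : ∀ᵐ x ∂μ, ∀ U ∈ TopologicalSpace.countableBasis X,
      ((∃ g : G, g • x ∈ U) ↔ ∀ᵐ z ∂μ, ∃ g : G, g • z ∈ U) := by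
    rw [ae_ball_iff hcb]
    intro U hU
    rcases hdich U hU with h | h
    · filter_upwards [h] with x hx
      exact ⟨fun _ => h, fun _ => hx⟩
    · filter_upwards [h] with x hx
      refine ⟨fun hx' => absurd hx' hx, fun h' => ?_⟩
      obtain ⟨z, hz, hz'⟩ := (h.and h').exists
      exact absurd hz' hz
  obtain ⟨x, hxfin, hx⟩ : ∃ x, ¬ (MulAction.orbit G x).Infinite ∧
      ∀ U ∈ TopologicalSpace.countableBasis X,
        ((∃ g : G, g • x ∈ U) ↔ ∀ᵐ z ∂μ, ∃ g : G, g • z ∈ U) := by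
    by_contra hcon
    refine hfin ?_
    filter_upwards [hZ] with x hx
    by_contra hx'
    exact hcon ⟨x, hx', hx⟩
  refine ⟨x, ?_⟩
  filter_upwards [hZ] with y hy
  by_contra hyx
  have hclosed : IsClosed (MulAction.orbit G x) := (Set.not_infinite.1 hxfin).isClosed
  obtain ⟨U, hU, hyU, hUx⟩ := (TopologicalSpace.isBasis_countableBasis X).exists_subset_of_mem_open
    (show y ∈ (MulAction.orbit G x)ᶜ from hyx) hclosed.isOpen_compl
  obtain ⟨g, hg⟩ := (hx U hU).2 ((hy U hU).1 ⟨1, by simpa using hyU⟩)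
  exact hUx hg ⟨g, rfl⟩

/-- The trace of a probability measure preserving action. -/
theorem isTrace_fixedMeasure [SMulInvariantMeasure G X μ] :
    IsTrace fun g : G => (fixedMeasure μ g : ℂ) := by
  refine ⟨isPositiveDefinite_iff.2 ⟨fun g => ?_, fun n g c => ?_⟩, ?_, fun g h => ?_⟩
  · simp [fixedMeasure_inv]
  · have hi : ∀ h : G, Integrable
        (fun x => (MulAction.fixedBy X h).indicator (1 : X → ℂ) x) μ := fun h =>
      (integrable_const (1 : ℂ)).indicator (measurableSet_fixedBy h)
    have hint : ∀ h : G, (fixedMeasure μ h : ℂ) =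
        ∫ x, (MulAction.fixedBy X h).indicator (1 : X → ℂ) x ∂μ := fun h => by
      rw [integral_indicator (measurableSet_fixedBy h)]
      simp [fixedMeasure]
    have hform : groupForm (fun h => (fixedMeasure μ h : ℂ)) g c =
        ∫ x, groupForm (fun h => (MulAction.fixedBy X h).indicator (1 : X → ℂ) x) g c ∂μ := by
      simp only [groupForm, hint]
      rw [integral_finsetSum _ fun i _ => integrable_finsetSum _ fun j _ =>
        ((hi _).mul_const _).const_mul _]
      refine Finset.sum_congr rfl fun i _ => ?_
      rw [integral_finsetSum _ fun j _ => ((hi _).mul_const _).const_mul _]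
      refine Finset.sum_congr rfl fun j _ => ?_
      rw [integral_const_mul, integral_mul_const]
    rw [hform]
    exact integral_nonneg fun x => groupForm_indicator_fixedBy_nonneg x g c
  · simp [fixedMeasure]
  · have : MulAction.fixedBy X (g * h * g⁻¹) = (g⁻¹ • ·) ⁻¹' MulAction.fixedBy X h := by
      ext x
      simp only [Set.mem_preimage, MulAction.mem_fixedBy, mul_smul]
      rw [eq_inv_smul_iff]
    simp only [fixedMeasure, measureReal_def]
    rw [this, measure_preimage_smul]

end Action

end CharRigid

theorem mainTheorem11 {Λ : Type*} [Group Λ] [Countable Λ]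
    (hrigid : CharRigid.IsCharacterRigid Λ)
    (hcount : CharRigid.HasCountablyManyFinDimUnitaryReps Λ)
    {X : Type*} [MeasurableSpace X] [StandardBorelSpace X]
    [MulAction Λ X] [MeasurableConstSMul Λ X]
    (μ : MeasureTheory.Measure X) [MeasureTheory.IsProbabilityMeasure μ] [ErgodicSMul Λ X μ] :
    CharRigid.IsEssentiallyTransitive Λ μ ∨
      ∀ g : Λ, g ∉ Subgroup.center Λ → μ (MulAction.fixedBy X g) = 0 := by
  have htr : CharRigid.IsTrace fun g : Λ => (CharRigid.fixedMeasure μ g : ℂ) :=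
    CharRigid.isTrace_fixedMeasure μ
  rcases htr.eq_zero_or_exists_isFiniteDimensionalCharacter hrigid hcount with
    h | ⟨χ, hχ, hfin, a, ha, hdom⟩
  · right
    intro g hg
    have := h g hg
    rw [Complex.ofReal_eq_zero] at this
    exact (measureReal_eq_zero_iff).1 this
  · left
    obtain ⟨ε, hε, hle⟩ := htr.positiveDefinite.exists_sq_sum_le hχ hfin ha hdom
    refine CharRigid.isEssentiallyTransitive_of_finite_orbits μ
      (CharRigid.not_ae_infinite_orbit μ hε fun c hc => ?_)
    have h1 := hle c.support c
    rw [hc.2, one_pow, mul_one] at h1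
    refine h1.trans ?_
    rw [CharRigid.realForm_apply]
    refine Finset.sum_le_sum fun g _ => Finset.sum_le_sum fun h _ => ?_
    have h2 := CharRigid.fixedMeasure_mem_Icc μ (g⁻¹ * h)
    rw [Complex.norm_real, Real.norm_eq_abs, sq_abs]
    -- Passing from φ² to φ uses 0 ≤ φ ≤ 1 and the nonnegativity of c.
    exact mul_le_mul_of_nonneg_left (pow_le_of_le_one h2.1 h2.2 two_ne_zero)
      (mul_nonneg (hc.1 g) (hc.1 h))
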